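/- Let $B_m(x)$, $m\ge 0$, denote the Bernoulli polynomials, defined by $$\frac{t e^{xt}}{e^t-1}=\sum_{m=0}^\infty B_m(x)\frac{t^m}{m!},$$ and for a sequence $(c_k)_{k\ge 0}$ of numbers and an integer $n\ge 0$ let $$H_n(c_k)=\det\big(c_{i+j}\big)_{0\le i,j\le n}$$ be its $n$th Hankel determinant, the determinant of a matrix of size $(n+1)\times(n+1)$. Then for all integers $n\ge 0$, $$H_n\big((2k+1)B_{2k}(\tfrac12)\big)=\prod_{\ell=1}^n\frac{(\ell!)^8}{(2\ell)!\,(2\ell+1)!}.$$ -/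

import Mathlib

/-- The `n`-th Hankel determinant `det (c (i + j))`, `0 ≤ i, j ≤ n`, of the sequence
`c 0, c 1, …`; it is the determinant of a matrix with `n + 1` rows and columns. -/
def hankelDet {R : Type*} [CommRing R] (c : ℕ → R) (n : ℕ) : R :=
  Matrix.det (Matrix.of fun i j : Fin (n + 1) => c ((i : ℕ) + (j : ℕ)))

/-! The sequence is the moment sequence of a functional on polynomials, so its Hankel determinant
equals the Gram determinant of any monic basis with one polynomial in each degree. In the basis q_k
= ∏_{j<k} (X - (j + 1/2)²), X q_k(X²) is a multiple of an explicit forward difference, which the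
Bernoulli functional turns into a derivative at 1/2 (`bernoulliMoment_halfOddProd`). A recurrence
then gives the Gram entries a_k a_m / (k + m + 1) with a_k = (-1)^k k!² (`bernoulliMoment_mul`).
Hence the determinant is ∏ a_k² times that of the Hilbert matrix, found by Schur complements. -/

open Polynomial in
/-- The linear functional on `ℚ[X]` sending `X ^ n` to `B_n(1/2)`. -/
noncomputable def bernoulliHalfFunctional : ℚ[X] →ₗ[ℚ] ℚ :=
  Polynomial.lsum fun n => LinearMap.toSpanSingleton ℚ ℚ ((Polynomial.bernoulli n).eval (1 / 2))

open Polynomial in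
theorem bernoulliHalfFunctional_X_pow (n : ℕ) :
    bernoulliHalfFunctional (X ^ n) = (Polynomial.bernoulli n).eval (1 / 2) := by
  rw [bernoulliHalfFunctional, Polynomial.lsum_apply, ← Polynomial.monomial_one_right_eq_X_pow,
    Polynomial.sum_monomial_index _ _ (by simp)]
  simp

open Polynomial in
theorem span_range_bernoulli : Submodule.span ℚ (Set.range Polynomial.bernoulli) = ⊤ := by
  rw [eq_top_iff]
  rintro p -
  induction p using Polynomial.induction_on' with
  | add p q hp hq => exact add_mem hp hq
  | monomial n a =>
    have h : monomial n a = (a / (n + 1)) •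
        ∑ k ∈ Finset.range (n + 1), ((n + 1).choose k : ℚ) • Polynomial.bernoulli k := by
      rw [Polynomial.sum_bernoulli, smul_monomial, smul_eq_mul, div_mul_cancel₀]
      positivity
    rw [h]
    exact Submodule.smul_mem _ _ (Submodule.sum_mem _ fun k _ =>
      Submodule.smul_mem _ _ (Submodule.subset_span ⟨k, rfl⟩))

open Polynomial in
/-- The functional inverts the forward difference operator. -/
theorem bernoulliHalfFunctional_difference (p : ℚ[X]) :
    bernoulliHalfFunctional (p.comp (1 + X) - p) = (derivative p).eval (1 / 2) := by
  have hp : p ∈ Submodule.span ℚ (Set.range Polynomial.bernoulli) := by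
    rw [span_range_bernoulli]; trivial
  induction hp using Submodule.span_induction with
  | mem x hx =>
    obtain ⟨n, rfl⟩ := hx
    -- On B_n the forward difference is n X^(n-1), so both sides are n B_{n-1}(1/2).
    rw [Polynomial.bernoulli_comp_one_add_X, add_sub_cancel_left, map_nsmul,
      bernoulliHalfFunctional_X_pow, Polynomial.derivative_bernoulli]
    simp
  | zero => simp
  | add x y _ _ hx hy =>
    rw [derivative_add, eval_add, ← hx, ← hy, ← map_add, add_comp]
    congr 1; ring
  | smul a x _ hx =>
    rw [derivative_smul, eval_smul, ← hx, ← map_smul, smul_comp, smul_sub]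

open Polynomial in
/-- The linear functional on `ℚ[X]` sending `X ^ k` to `(2 k + 1) B_{2k}(1/2)`. -/
noncomputable def bernoulliMoment : ℚ[X] →ₗ[ℚ] ℚ :=
  bernoulliHalfFunctional ∘ₗ derivative ∘ₗ LinearMap.mulLeft ℚ X ∘ₗ (aeval (X ^ 2)).toLinearMap

open Polynomial in
theorem bernoulliMoment_apply (p : ℚ[X]) :
    bernoulliMoment p = bernoulliHalfFunctional (derivative (X * p.comp (X ^ 2))) := rfl

open Polynomial in
theorem bernoulliMoment_X_pow (k : ℕ) :
    bernoulliMoment (X ^ k) = (2 * (k : ℚ) + 1) * (Polynomial.bernoulli (2 * k)).eval (1 / 2) := by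
  have h : (X * (X ^ k : ℚ[X]).comp (X ^ 2)) = X ^ (2 * k + 1) := by
    rw [X_pow_comp, ← pow_mul, pow_succ']
  rw [bernoulliMoment_apply, h, derivative_X_pow, ← smul_eq_C_mul, map_smul,
    Nat.add_sub_cancel, bernoulliHalfFunctional_X_pow]
  simp

open Polynomial in
/-- The monic polynomial `∏_{j < k} (X - (j + 1/2)²)`. -/
noncomputable def halfOddProd (k : ℕ) : ℚ[X] :=
  ∏ j ∈ Finset.range k, (X - C (((j : ℚ) + 1 / 2) ^ 2))

open Polynomial in
theorem halfOddProd_succ (k : ℕ) :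
    halfOddProd (k + 1) = halfOddProd k * (X - C (((k : ℚ) + 1 / 2) ^ 2)) :=
  Finset.prod_range_succ _ _

theorem halfOddProd_monic (k : ℕ) : (halfOddProd k).Monic :=
  Polynomial.monic_prod_X_sub_C _ _

theorem natDegree_halfOddProd (k : ℕ) : (halfOddProd k).natDegree = k :=
  (Polynomial.natDegree_finsetProd_X_sub_C_eq_card _ _).trans (Finset.card_range k)

open Polynomial in
/-- The product `∏_{j = 1}^{k} (X² - j²)`, centred at `1/2`. -/
noncomputable def centredProd (k : ℕ) : ℚ[X] :=
  ∏ j ∈ Finset.range k, ((X - C (1 / 2)) ^ 2 - C (((j : ℚ) + 1) ^ 2))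

open Polynomial in
theorem centredProd_succ (k : ℕ) :
    centredProd (k + 1) = centredProd k * ((X - C (1 / 2)) ^ 2 - C (((k : ℚ) + 1) ^ 2)) :=
  Finset.prod_range_succ _ _

open Polynomial in
theorem eval_centredProd (k : ℕ) :
    (centredProd k).eval (1 / 2) = (-1) ^ k * (k.factorial : ℚ) ^ 2 := by
  induction k with
  | zero => simp [centredProd]
  | succ k ih =>
    rw [centredProd_succ, eval_mul, ih, Nat.factorial_succ]
    simp
    ring

open Polynomial in
theorem eval_mul_centredProd (k : ℕ) (s : ℚ) :
    (s - 1 / 2) * (centredProd k).eval s = (s - k - 1 / 2) * (halfOddProd k).eval (s ^ 2) := by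
  induction k with
  | zero => simp [centredProd, halfOddProd]
  | succ k ih =>
    simp only [centredProd_succ, halfOddProd_succ, eval_mul, eval_sub, eval_pow, eval_X, eval_C]
    push_cast
    linear_combination ((s - 1 / 2) ^ 2 - (k + 1) ^ 2) * ih

open Polynomial in
theorem eval_mul_centredProd_one_add (k : ℕ) (s : ℚ) :
    (s + 1 / 2) * (centredProd k).eval (1 + s) =
      (s + k + 1 / 2) * (halfOddProd k).eval (s ^ 2) := by
  induction k with
  | zero => simp [centredProd, halfOddProd]
  | succ k ih =>
    simp only [centredProd_succ, halfOddProd_succ, eval_mul, eval_sub, eval_pow, eval_X, eval_C]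
    push_cast
    linear_combination ((s + 1 / 2) ^ 2 - (k + 1) ^ 2) * ih

-- By the two preceding identities both terms contain q_k(s²); the cofactors (s + 1/2)(s + k + 1/2)
-- and (s - 1/2)(s - k - 1/2) differ by 2(k + 1)s.
open Polynomial in
theorem difference_centredProd (k : ℕ) :
    ((X - C (1 / 2)) ^ 2 * centredProd k).comp (1 + X) - (X - C (1 / 2)) ^ 2 * centredProd k =
      (2 * ((k : ℚ) + 1)) • (X * (halfOddProd k).comp (X ^ 2)) := by
  refine Polynomial.funext fun s => ?_
  simp only [eval_sub, eval_comp, eval_mul, eval_pow, eval_X, eval_C, eval_add, eval_one,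
    eval_smul, smul_eq_mul]
  linear_combination (s + 1 / 2) * eval_mul_centredProd_one_add k s
    - (s - 1 / 2) * eval_mul_centredProd k s

open Polynomial in
theorem bernoulliMoment_halfOddProd (k : ℕ) :
    bernoulliMoment (halfOddProd k) = (-1) ^ k * (k.factorial : ℚ) ^ 2 / (k + 1) := by
  have h := bernoulliHalfFunctional_difference
    (derivative ((X - C (1 / 2)) ^ 2 * centredProd k))
  have hd : (derivative ((X - C (1 / 2)) ^ 2 * centredProd k)).comp (1 + X) =
      derivative (((X - C (1 / 2)) ^ 2 * centredProd k).comp (1 + X)) := by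
    rw [derivative_comp]; simp
  rw [hd, ← derivative_sub, difference_centredProd, derivative_smul, map_smul,
    ← bernoulliMoment_apply] at h
  -- The double zero at 1/2 kills every term except the one where the square is differentiated
  -- twice.
  have he : (derivative (derivative ((X - C (1 / 2)) ^ 2 * centredProd k))).eval (1 / 2) =
      2 * (centredProd k).eval (1 / 2) := by
    simp [derivative_pow]
  rw [he, eval_centredProd, smul_eq_mul] at h
  rw [eq_div_iff (by positivity)]
  linear_combination h / 2

-- The two products differ only in their last linear factor, and (k + 1/2)² - (m + 1/2)² = (k - m)(k
-- + m + 1).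
open Polynomial in
theorem bernoulliMoment_mul_succ (k m : ℕ) :
    bernoulliMoment (halfOddProd k * halfOddProd (m + 1)) =
      bernoulliMoment (halfOddProd (k + 1) * halfOddProd m) +
        ((k : ℚ) - m) * (k + m + 1) * bernoulliMoment (halfOddProd k * halfOddProd m) := by
  rw [← smul_eq_mul (_ * _) (bernoulliMoment _), ← map_smul, ← map_add]
  congr 1
  rw [halfOddProd_succ, halfOddProd_succ, smul_eq_C_mul]
  simp only [map_mul, map_sub, map_add, map_pow, map_one]
  have h2 : (C (1 / 2 : ℚ) : ℚ[X]) * 2 = 1 := by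
    rw [← C_ofNat, ← C_mul]; norm_num
  linear_combination (halfOddProd k * halfOddProd m * (C (k : ℚ) - C (m : ℚ))) * h2

/-- The Gram matrix of the polynomials `halfOddProd k` is a rescaled Hilbert matrix. -/
theorem bernoulliMoment_mul (k m : ℕ) :
    bernoulliMoment (halfOddProd k * halfOddProd m) =
      ((-1) ^ k * (k.factorial : ℚ) ^ 2) * (((-1) ^ m * (m.factorial : ℚ) ^ 2) *
        (1 / ((k : ℚ) + m + 1))) := by
  induction m generalizing k with
  | zero =>
    have h : halfOddProd 0 = 1 := by simp [halfOddProd]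
    rw [h, mul_one, bernoulliMoment_halfOddProd]
    simp
    ring
  | succ m ih =>
    rw [bernoulliMoment_mul_succ, ih, ih, Nat.factorial_succ, Nat.factorial_succ]
    push_cast
    have h1 : (k : ℚ) + m + 1 ≠ 0 := by positivity
    have h2 : (k : ℚ) + 1 + m + 1 ≠ 0 := by positivity
    have h3 : (k : ℚ) + (m + 1) + 1 ≠ 0 := by positivity
    field_simp
    ring

/-- The change of basis from monomials is unitriangular, so the congruence it induces preserves the
determinant. -/
theorem hankelDet_eq_det_gram {R : Type*} [CommRing R] (L : Polynomial R →ₗ[R] R)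
    (p : ℕ → Polynomial R) (hdeg : ∀ k, (p k).natDegree = k) (hmonic : ∀ k, (p k).Monic) (n : ℕ) :
    hankelDet (fun k => L (Polynomial.X ^ k)) n =
      (Matrix.of fun i j : Fin (n + 1) => L (p i * p j)).det := by
  set A : Matrix (Fin (n + 1)) (Fin (n + 1)) R :=
    Matrix.of fun i j => (p j).coeff i with hA
  have hdet : A.det = 1 :=
    Matrix.det_matrixOfPolynomials (fun i : Fin (n + 1) => p i) (fun i => hdeg i)
      fun i => hmonic i
  have hexp (i : Fin (n + 1)) :
      p i = ∑ a : Fin (n + 1), A a i • (Polynomial.X : Polynomial R) ^ (a : ℕ) := by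
    conv_lhs => rw [(p i).as_sum_range' (n + 1) (by rw [hdeg]; exact i.2)]
    rw [← Fin.sum_univ_eq_sum_range (fun a => Polynomial.monomial a ((p i).coeff a))]
    exact Finset.sum_congr rfl fun a _ => by
      rw [← Polynomial.C_mul_X_pow_eq_monomial, Polynomial.smul_eq_C_mul]; rfl
  have hmul : (Matrix.of fun i j : Fin (n + 1) => L (p i * p j)) =
      A.transpose * (Matrix.of fun i j : Fin (n + 1) =>
        L (Polynomial.X ^ ((i : ℕ) + (j : ℕ)))) * A := by
    ext i j
    simp only [Matrix.of_apply, Matrix.mul_apply, Matrix.transpose_apply]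
    rw [hexp i, hexp j, Finset.sum_mul_sum, Finset.sum_comm, map_sum]
    refine Finset.sum_congr rfl fun b _ => ?_
    rw [map_sum, Finset.sum_mul]
    refine Finset.sum_congr rfl fun a _ => ?_
    rw [smul_mul_smul_comm, map_smul, smul_eq_mul, pow_add]
    ring
  rw [hmul, Matrix.det_mul, Matrix.det_mul, Matrix.det_transpose, hdet, hankelDet]
  simp

theorem det_succ_eq_mul_det_schur {K : Type*} [Field K] {n : ℕ}
    (M : Matrix (Fin (n + 1)) (Fin (n + 1)) K) (hM : M (Fin.last n) (Fin.last n) ≠ 0) :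
    M.det = M (Fin.last n) (Fin.last n) * (Matrix.of fun i j : Fin n =>
      M i.castSucc j.castSucc - M i.castSucc (Fin.last n) * M (Fin.last n) j.castSucc /
        M (Fin.last n) (Fin.last n)).det := by
  have hD : IsUnit (M.submatrix (Fin.natAdd n) (Fin.natAdd n) : Matrix (Fin 1) (Fin 1) K) := by
    rw [Matrix.isUnit_iff_isUnit_det, Matrix.det_fin_one]
    exact isUnit_iff_ne_zero.mpr hM
  rw [← Matrix.det_submatrix_equiv_self (finSumFinEquiv (m := n) (n := 1)) M,
    ← Matrix.fromBlocks_toBlocks (M.submatrix finSumFinEquiv finSumFinEquiv)]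
  let _ : Invertible (M.submatrix (finSumFinEquiv (m := n) (n := 1)) finSumFinEquiv).toBlocks₂₂ :=
    hD.invertible
  rw [Matrix.det_fromBlocks₂₂, Matrix.det_fin_one, Matrix.invOf_eq_nonsing_inv, Matrix.inv_def,
    Matrix.det_fin_one, Matrix.adjugate_fin_one]
  congr 2
  ext i j
  have h0 : (Fin.natAdd n (0 : Fin 1)) = Fin.last n := rfl
  have h1 (a : Fin n) : Fin.castAdd 1 a = a.castSucc := rfl
  simp only [Matrix.mul_apply, Matrix.toBlocks₂₂, Matrix.toBlocks₁₂, Matrix.toBlocks₂₁,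
    Matrix.toBlocks₁₁, Ring.inverse_eq_inv', Matrix.sub_apply, Matrix.of_apply,
    Matrix.submatrix_apply, finSumFinEquiv_apply_left, finSumFinEquiv_apply_right,
    Finset.univ_unique, Finset.sum_singleton, Fin.default_eq_zero, Matrix.smul_apply,
    Matrix.one_apply_eq, smul_eq_mul, mul_one, h0, h1]
  ring

theorem prod_sub_div_add_one (N : ℕ) :
    ∏ i : Fin N, ((N : ℚ) - i) / (i + N + 1) = (N.factorial : ℚ) ^ 2 / ((2 * N).factorial : ℚ) := by
  rw [Finset.prod_div_distrib, Fin.prod_univ_eq_prod_range (fun i => (N : ℚ) - i),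
    Fin.prod_univ_eq_prod_range (fun i => (i : ℚ) + N + 1)]
  have h1 : ∏ i ∈ Finset.range N, ((N : ℚ) - i) = N.factorial := by
    rw [← Nat.descFactorial_self, Nat.descFactorial_eq_prod_range, Nat.cast_prod]
    exact Finset.prod_congr rfl fun i hi => by
      rw [Nat.cast_sub (Finset.mem_range.mp hi).le]
  have h2 : (N.factorial : ℚ) * ∏ i ∈ Finset.range N, ((i : ℚ) + N + 1) = (2 * N).factorial := by
    rw [two_mul, ← Nat.factorial_mul_ascFactorial, Nat.ascFactorial_eq_prod_range]
    push_cast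
    congr 1
    exact Finset.prod_congr rfl fun i _ => by ring
  rw [h1, ← h2]
  have : (N.factorial : ℚ) ≠ 0 := by positivity
  rw [sq, mul_div_mul_left _ _ this]

/-- The recurrence for the determinant of the Hilbert matrix `1 / (i + j + 1)`. -/
theorem hankelDet_hilbert_succ (n : ℕ) :
    hankelDet (fun k : ℕ => 1 / ((k : ℚ) + 1)) (n + 1) =
      ((n + 1).factorial : ℚ) ^ 4 /
        (((2 * (n + 1)).factorial : ℚ) * ((2 * (n + 1) + 1).factorial : ℚ)) *
      hankelDet (fun k : ℕ => 1 / ((k : ℚ) + 1)) n := by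
  -- With N = n + 1, eliminating the last row and column leaves 1/(i+j+1) - (2N+1)/((i+N+1)(j+N+1))
  -- = v_i v_j/(i+j+1), a rescaled smaller Hilbert matrix.
  set v : Fin (n + 1) → ℚ := fun i => (((n + 1 : ℕ) : ℚ) - i) / (i + (n + 1 : ℕ) + 1)
  set H : Matrix (Fin (n + 1)) (Fin (n + 1)) ℚ :=
    Matrix.of fun i j => 1 / (((i : ℕ) + (j : ℕ) : ℕ) + 1 : ℚ)
  have hv : ∏ i, v i = ((n + 1).factorial : ℚ) ^ 2 / ((2 * (n + 1)).factorial : ℚ) :=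
    prod_sub_div_add_one (n + 1)
  have hschur : (Matrix.of fun i j => v i * (v j * H i j)).det =
      (∏ i, v i) * ((∏ i, v i) * H.det) := by
    rw [← Matrix.det_mul_row, ← Matrix.det_mul_column]
    rfl
  have hlast : ((n + 1 : ℕ) + (n + 1 : ℕ) : ℚ) + 1 ≠ 0 := by positivity
  rw [hankelDet, det_succ_eq_mul_det_schur]
  · have hentry : (Matrix.of fun i j : Fin (n + 1) => v i * (v j * H i j)) =
        Matrix.of fun i j : Fin (n + 1) => 1 / (((i : ℕ) + (j : ℕ) : ℕ) + 1 : ℚ) -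
          1 / (((i : ℕ) + (n + 1) : ℕ) + 1 : ℚ) * (1 / (((n + 1) + (j : ℕ) : ℕ) + 1 : ℚ)) /
            (1 / (((n + 1) + (n + 1) : ℕ) + 1 : ℚ)) := by
      ext i j
      simp only [v, H, Matrix.of_apply]
      push_cast
      have h1 : ((i : ℕ) : ℚ) + (j : ℕ) + 1 ≠ 0 := by positivity
      have h2 : ((i : ℕ) : ℚ) + (n + 1) + 1 ≠ 0 := by positivity
      have h3 : ((j : ℕ) : ℚ) + (n + 1) + 1 ≠ 0 := by positivity
      have h4 : (n : ℚ) + 1 + (j : ℕ) + 1 ≠ 0 := by positivity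
      have h5 : (n : ℚ) + 1 + (n + 1) + 1 ≠ 0 := by positivity
      field_simp
      ring
    simp only [Matrix.of_apply, Fin.val_last, Fin.val_castSucc]
    rw [← hentry, hschur, hv, show hankelDet (fun k : ℕ => 1 / ((k : ℚ) + 1)) n = H.det from rfl,
      Nat.factorial_succ (2 * (n + 1))]
    have h6 : ((2 * (n + 1)).factorial : ℚ) ≠ 0 := by positivity
    push_cast
    field_simp
    ring
  · simp only [Matrix.of_apply, Fin.val_last]
    positivity

/-- The determinant of the Hilbert matrix `1 / (i + j + 1)`. -/
theorem hankelDet_hilbert (n : ℕ) :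
    hankelDet (fun k : ℕ => 1 / ((k : ℚ) + 1)) n =
      ∏ l ∈ Finset.Icc 1 n, (l.factorial : ℚ) ^ 4 /
        (((2 * l).factorial : ℚ) * ((2 * l + 1).factorial : ℚ)) := by
  induction n with
  | zero => simp [hankelDet]
  | succ n ih => rw [Finset.prod_Icc_succ_top (by omega), hankelDet_hilbert_succ, ih, mul_comm]

theorem corollary5p4 (n : ℕ) :
    hankelDet (fun k : ℕ => (2 * (k : ℚ) + 1) * (Polynomial.bernoulli (2 * k)).eval (1 / 2 : ℚ)) n =
      ∏ l ∈ Finset.Icc 1 n,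
        (Nat.factorial l : ℚ) ^ 8 /
          ((Nat.factorial (2 * l) : ℚ) * (Nat.factorial (2 * l + 1) : ℚ)) := by
  simp_rw [← bernoulliMoment_X_pow]
  rw [hankelDet_eq_det_gram bernoulliMoment halfOddProd natDegree_halfOddProd halfOddProd_monic]
  simp_rw [bernoulliMoment_mul]
  have hcol := Matrix.det_mul_column (fun i : Fin (n + 1) => (-1) ^ (i : ℕ) * ((i : ℕ).factorial : ℚ) ^ 2)
    (Matrix.of fun i j : Fin (n + 1) => ((-1) ^ (j : ℕ) * ((j : ℕ).factorial : ℚ) ^ 2) *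
        (1 / (((i : ℕ) : ℚ) + (j : ℕ) + 1)))
  have hrow := Matrix.det_mul_row (fun i : Fin (n + 1) => (-1) ^ (i : ℕ) * ((i : ℕ).factorial : ℚ) ^ 2)
    (Matrix.of fun i j : Fin (n + 1) => (1 / (((i : ℕ) : ℚ) + (j : ℕ) + 1)))
  have hhil := hankelDet_hilbert n
  simp only [hankelDet, Nat.cast_add] at hhil
  simp only [Matrix.of_apply] at hcol hrow
  -- Row and column scalings together square the signs away, and the index 0 contributes 1.
  have hprod : ∏ i : Fin (n + 1), (-1) ^ (i : ℕ) * ((i : ℕ).factorial : ℚ) ^ 2 *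
      ((-1) ^ (i : ℕ) * ((i : ℕ).factorial : ℚ) ^ 2) =
      ∏ l ∈ Finset.Icc 1 n, (l.factorial : ℚ) ^ 4 := by
    rw [Fin.prod_univ_eq_prod_range (fun i => (-1) ^ i * ((i.factorial : ℚ)) ^ 2 *
      ((-1) ^ i * (i.factorial : ℚ) ^ 2)), Finset.range_eq_Ico,
      Finset.prod_eq_prod_Ico_succ_bot (Nat.succ_pos n), ← Finset.Ico_add_one_right_eq_Icc]
    simp only [pow_zero, Nat.factorial_zero, Nat.cast_one, one_pow, one_mul, zero_add]
    refine Finset.prod_congr rfl fun l _ => ?_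
    rw [mul_mul_mul_comm, ← mul_pow, neg_one_mul, neg_neg, one_pow, one_mul]
    ring
  rw [hcol, hrow, hhil, ← mul_assoc, ← Finset.prod_mul_distrib, hprod, ← Finset.prod_mul_distrib]
  exact Finset.prod_congr rfl fun l _ => by ring
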